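/- Let $\mathbb{F}$ be a field, let $\mathsf{Vec}_{\mathbb{F}}$ be the category of $\mathbb{F}$-vector spaces, and regard $[0,\infty]^2$ with the product order as a category. Let $F\colon [0,\infty]^2 \to \mathsf{Vec}_{\mathbb{F}}$ be a functor that is pointwise finite-dimensional (every $F(x)$ is finite-dimensional) and middle-exact: for all $x,y \in [0,\infty]^2$ the sequence $$F(x\wedge y) \longrightarrow F(x)\oplus F(y) \longrightarrow F(x\vee y),$$ whose first map has as components the two structure maps of $F$ and whose second map is the difference of the two structure maps, is exact at $F(x)\oplus F(y)$. An interval in a poset $P$ is a subset $I\subseteq P$ that is convex ($x,y\in I$ and $x\le z\le y$ imply $z\in I$) and in which any two points are joined by a finite zigzag of comparable points of $I$. Its interval module $\mathbb{F}_I\colon P\to\mathsf{Vec}_{\mathbb{F}}$ has value $\mathbb{F}$ at the points of $I$ and $0$ elsewhere, and its structure map $\mathbb{F}_I(x\le y)$ is $\mathrm{id}_{\mathbb{F}}$ if $x,y\in I$ and $0$ otherwise. A block is an interval $I\subseteq[0,\infty]^2$ of one of the following forms: - $I=J_1\times J_2$ with $J_1,J_2\subseteq[0,\infty]$ down-closed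 (death block); - $I=J_1\times J_2$ with $J_1,J_2\subseteq[0,\infty]$ up-closed (birth block); - $I=J\times[0,\infty]$ with $J\subseteq[0,\infty]$ an interval (vertical block); - $I=[0,\infty]\times J$ with $J\subseteq[0,\infty]$ an interval (horizontal block). Then $F$ decomposes into a direct sum of interval modules over blocks: there is a family $(B_i)_{i\in\iota}$ of blocks (repetitions allowed) such that $$F\;\cong\;\bigoplus_{i\in\iota}\mathbb{F}_{B_i}.$$ -/

import Mathlib

universe u

open CategoryTheory CategoryTheory.Limits

open scoped ENNReal

noncomputable section

/-- A persistence module over a poset `P`: a functor from `P`, viewed as a category through its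
order, to vector spaces over `K`. -/
abbrev PersistenceModule (K : Type u) [Field K] (P : Type) [PartialOrder P] : Type (max 0 (u + 1)) :=
  @Functor P (Preorder.smallCategory P) (ModuleCat.{u} K) _

/-- Pointwise finite-dimensional persistence modules. -/
def IsPointwiseFiniteDimensional {K : Type u} [Field K] {P : Type} [PartialOrder P]
    (F : PersistenceModule K P) : Prop :=
  ∀ x : P, FiniteDimensional K (F.obj x)

/-- A commuting square (top `α : A ⟶ B`, left `f : A ⟶ C`, right `g : B ⟶ D`, bottom
`β : C ⟶ D`) in an abelian category is middle-exact if its associated complex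
`A ⟶ B ⊞ C ⟶ D`, with maps `(α, f)` and `(g, -β)`, is exact. -/
def MiddleExactSquare {𝒜 : Type*} [Category 𝒜] [Abelian 𝒜] {A B C D : 𝒜}
    {α : A ⟶ B} {f : A ⟶ C} {g : B ⟶ D} {β : C ⟶ D} (sq : CommSq α f g β) : Prop :=
  (ShortComplex.mk (biprod.lift α f) (biprod.desc g (-β)) (by simp [sq.w])).Exact

/-- The commuting square `F (x ⊓ y) ⟶ F x`, `F (x ⊓ y) ⟶ F y`, `F x ⟶ F (x ⊔ y)`,
`F y ⟶ F (x ⊔ y)`. -/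
theorem PersistenceModule.infSupSquare {K : Type u} [Field K] {P : Type} [Lattice P]
    (F : PersistenceModule K P) (x y : P) :
    CommSq (F.map (homOfLE (inf_le_left : x ⊓ y ≤ x))) (F.map (homOfLE (inf_le_right : x ⊓ y ≤ y)))
      (F.map (homOfLE (le_sup_left : x ≤ x ⊔ y))) (F.map (homOfLE (le_sup_right : y ≤ x ⊔ y))) :=
  ⟨by rw [← F.map_comp, ← F.map_comp]; rfl⟩

/-- A bipersistence module over `S × T` (with the product order) is middle-exact if for all
`x, y` the square on `x ⊓ y, x, y, x ⊔ y` is sent to a middle-exact square. -/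
def IsMiddleExact {K : Type u} [Field K] {S T : Type} [LinearOrder S] [LinearOrder T]
    (F : PersistenceModule K (S × T)) : Prop :=
  ∀ x y : S × T, MiddleExactSquare (F.infSupSquare x y)

/-- An interval in a poset: a convex subset in which any two points are joined by a finite
zigzag of comparable points of the subset. -/
structure IsInterval {P : Type} [PartialOrder P] (I : Set P) : Prop where
  convex : ∀ ⦃x y z : P⦄, x ∈ I → y ∈ I → x ≤ z → z ≤ y → z ∈ I
  connected : ∀ x y : I, Relation.ReflTransGen (fun a b : I => a ≤ b ∨ b ≤ a) x y

open Classical in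
/-- The interval module of `I`: it is `K` on `I` and `0` off `I`; the map from `x` to `y` is the
identity of `K` if both points lie in `I`, and `0` otherwise. -/
def intervalModule (K : Type u) [Field K] {P : Type} [PartialOrder P] {I : Set P}
    (hI : IsInterval I) : PersistenceModule K P where
  obj x := if x ∈ I then ModuleCat.of K K else ModuleCat.of K PUnit
  map {x y} _ := if h : x ∈ I ∧ y ∈ I then
      eqToHom (if_pos h.1) ≫ 𝟙 (ModuleCat.of K K) ≫ eqToHom (if_pos h.2).symm
    else 0
  map_id x := by
    by_cases hx : x ∈ I
    · simp [hx]
    · rw [dif_neg (fun h => hx h.1)]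
      refine (IsZero.eq_of_src ?_ _ _)
      rw [if_neg hx]
      exact ModuleCat.isZero_of_subsingleton _
  map_comp {x y z} f g := by
    by_cases hx : x ∈ I
    · by_cases hz : z ∈ I
      · have hy : y ∈ I := hI.convex hx hz (leOfHom f) (leOfHom g)
        simp [hx, hy, hz]
      · simp [hz]
    · simp [hx]

/-- Death blocks: products of two down-closed subsets of `[0, ∞]`. -/
def IsDeathBlock (I : Set (ℝ≥0∞ × ℝ≥0∞)) : Prop :=
  ∃ J₁ J₂ : Set ℝ≥0∞, IsLowerSet J₁ ∧ IsLowerSet J₂ ∧ I = J₁ ×ˢ J₂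

/-- Birth blocks: products of two up-closed subsets of `[0, ∞]`. -/
def IsBirthBlock (I : Set (ℝ≥0∞ × ℝ≥0∞)) : Prop :=
  ∃ J₁ J₂ : Set ℝ≥0∞, IsUpperSet J₁ ∧ IsUpperSet J₂ ∧ I = J₁ ×ˢ J₂

/-- Vertical blocks `J × [0, ∞]`, with `J` an interval. -/
def IsVerticalBlock (I : Set (ℝ≥0∞ × ℝ≥0∞)) : Prop :=
  ∃ J : Set ℝ≥0∞, IsInterval J ∧ I = J ×ˢ (Set.univ : Set ℝ≥0∞)

/-- Horizontal blocks `[0, ∞] × J`, with `J` an interval. -/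
def IsHorizontalBlock (I : Set (ℝ≥0∞ × ℝ≥0∞)) : Prop :=
  ∃ J : Set ℝ≥0∞, IsInterval J ∧ I = (Set.univ : Set ℝ≥0∞) ×ˢ J

/-- A block is an interval in `[0, ∞]²` of one of the four types above. -/
structure IsBlock (I : Set (ℝ≥0∞ × ℝ≥0∞)) : Prop where
  isInterval : IsInterval I
  cases : IsDeathBlock I ∨ IsBirthBlock I ∨ IsVerticalBlock I ∨ IsHorizontalBlock I

end

/-!
Middle-exactness lets elements be lifted along rectangles, so the kernel of a structure map out of
the bottom corner is the sum of the kernels of its two coordinate maps, and the image of a structure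
map into the top corner is the intersection of the two coordinate images. Each corner space thus
carries two flags, and there is a vector together with a functional taking the value one on it that
is compatible with both. The vector pushes forward and pulls back to all points of its lifespan, and
so does the functional (by a direct limit and, dually, by finite-dimensionality). This splits off
an interval module, over a death block at the bottom corner and a birth block at the top corner. If
both corner spaces vanish, the module is the direct sum of the pullbacks of its restrictions to the
two top edges, and the same argument on a linear order splits off a vertical or horizontal block.

Since every nonzero retract of the module therefore has a block as a summand, a maximal orthogonal
family of block summands exhausts it: by finite-dimensionality such a family is finite at each
point, so its projections can be added up, and maximality forces their sum to be the identity.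
-/

section LinearAlgebra

variable {K V : Type*} [Field K] [AddCommGroup V] [Module K V]

/-- A subspace is adapted to a vector `v` and a functional `φ` with `φ v = 1` if it is compatible
with the splitting of the line `K ∙ v` that they define: it contains `v` or is killed by `φ`. -/
def IsAdapted (v : V) (φ : Module.Dual K V) (U : Submodule K V) : Prop :=
  v ∈ U ∨ U ≤ LinearMap.ker φ

namespace IsAdapted

variable {v : V} {φ : Module.Dual K V} {U W : Submodule K V}

theorem sup (hU : IsAdapted v φ U) (hW : IsAdapted v φ W) : IsAdapted v φ (U ⊔ W) := by
  rcases hU with hU | hU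
  · exact .inl (Submodule.mem_sup_left hU)
  rcases hW with hW | hW
  · exact .inl (Submodule.mem_sup_right hW)
  exact .inr (sup_le hU hW)

theorem inf (hU : IsAdapted v φ U) (hW : IsAdapted v φ W) : IsAdapted v φ (U ⊓ W) := by
  rcases hU with hU | hU
  · rcases hW with hW | hW
    · exact .inl ⟨hU, hW⟩
    · exact .inr (inf_le_right.trans hW)
  · exact .inr (inf_le_left.trans hU)

theorem le_ker_iff (hU : IsAdapted v φ U) (hv : φ v = 1) : U ≤ LinearMap.ker φ ↔ v ∉ U :=
  ⟨fun h hvU => one_ne_zero (hv.symm.trans (h hvU)), hU.resolve_left⟩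

theorem mem_sup_iff (hU : IsAdapted v φ U) (hW : IsAdapted v φ W) (hv : φ v = 1) :
    v ∈ U ⊔ W ↔ v ∈ U ∨ v ∈ W := by
  rw [← not_iff_not, not_or, ← hU.le_ker_iff hv, ← hW.le_ker_iff hv,
    ← (hU.sup hW).le_ker_iff hv, sup_le_iff]

end IsAdapted

theorem exists_least_of_isChain {α : Type*} [PartialOrder α] [OrderTop α] [WellFoundedLT α]
    {c : Set α} (hc : IsChain (· ≤ ·) c) {p : α → Prop} (htop : p ⊤) :
    ∃ a, p a ∧ ∀ b ∈ c, p b → a ≤ b := by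
  by_cases hne : ∃ b ∈ c, p b
  · obtain ⟨a, ⟨hac, hpa⟩, hmin⟩ := wellFounded_lt.has_min {b | b ∈ c ∧ p b} hne
    refine ⟨a, hpa, fun b hbc hpb => ?_⟩
    exact (hc.total hac hbc).elim id fun hba => (eq_of_le_of_not_lt hba (hmin b ⟨hbc, hpb⟩)).ge
  · exact ⟨⊤, htop, fun b hbc hpb => (hne ⟨b, hbc, hpb⟩).elim⟩

/-- One step of the Bruhat decomposition of a pair of flags. -/
theorem exists_isAdapted_of_isChain [FiniteDimensional K V] [Nontrivial V]
    {𝒜 ℬ : Set (Submodule K V)} (h𝒜 : IsChain (· ≤ ·) 𝒜) (hℬ : IsChain (· ≤ ·) ℬ) :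
    ∃ (v : V) (φ : Module.Dual K V), φ v = 1 ∧ ∀ U ∈ 𝒜 ∪ ℬ, IsAdapted v φ U := by
  obtain ⟨A, hA, hA_le⟩ := exists_least_of_isChain h𝒜 (p := (· ≠ ⊥)) top_ne_bot
  obtain ⟨B, hB, hB_le⟩ := exists_least_of_isChain hℬ (p := fun U => A ⊓ U ≠ ⊥) (by simpa using hA)
  obtain ⟨C, hC, hC_ge⟩ := exists_least_of_isChain (α := (Submodule K V)ᵒᵈ) hℬ.symm
    (p := fun U => A ⊓ OrderDual.ofDual U = ⊥) (inf_bot_eq A)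
  obtain ⟨v, ⟨hvA, hvB⟩, hv⟩ := Submodule.exists_mem_ne_zero_of_ne_bot hB
  have hvC : v ∉ OrderDual.ofDual C := fun h => hv (by
    simpa using hC.le (show v ∈ A ⊓ OrderDual.ofDual C from ⟨hvA, h⟩))
  obtain ⟨φ, hφC, hφv⟩ := LinearMap.exists_extend_of_notMem (f := 0) hvC (1 : K)
  have hC_le_ker : OrderDual.ofDual C ≤ LinearMap.ker φ := fun x hx =>
    LinearMap.congr_fun hφC ⟨x, hx⟩
  refine ⟨v, φ, hφv, ?_⟩
  rintro U (hU | hU)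
  · by_cases hU₀ : U = ⊥
    · exact .inr (hU₀ ▸ bot_le)
    · exact .inl (hA_le U hU hU₀ hvA)
  · by_cases hAU : A ⊓ U = ⊥
    · exact .inr (le_trans (OrderDual.ofDual_le_ofDual.2 (hC_ge (.toDual U) hU hAU)) hC_le_ker)
    · exact .inl (hB_le U hU hAU hvB)

end LinearAlgebra

section CompatibleFamilies

variable {K : Type*} [Field K] {ι : Type*} [Preorder ι] [IsDirectedOrder ι] {i₀ : ι}
  {G : ι → Type*} [∀ i, AddCommGroup (G i)] [∀ i, Module K (G i)]

theorem exists_compatible_functionals (hi₀ : IsBot i₀) (f : ∀ i j, i ≤ j → G i →ₗ[K] G j)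
    [DirectedSystem G (f · · ·)] {φ₀ : Module.Dual K (G i₀)}
    (hφ₀ : ∀ i, LinearMap.ker (f i₀ i (hi₀ i)) ≤ LinearMap.ker φ₀) :
    ∃ φ : ∀ i, Module.Dual K (G i), φ i₀ = φ₀ ∧ ∀ i j h, φ j ∘ₗ f i j h = φ i := by
  classical
  let of := Module.DirectLimit.of K ι G f
  have hmem : φ₀ ∈ (LinearMap.ker (of i₀)).dualAnnihilator := by
    rw [Submodule.mem_dualAnnihilator]
    intro x hx
    obtain ⟨j, _, hxj⟩ := Module.DirectLimit.of.zero_exact (LinearMap.mem_ker.1 hx)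
    exact hφ₀ j hxj
  rw [← LinearMap.range_dualMap_eq_dualAnnihilator_ker] at hmem
  obtain ⟨ψ, rfl⟩ := hmem
  exact ⟨fun i => ψ ∘ₗ of i, rfl, fun i j h => LinearMap.ext fun x => by simp [of]⟩

/-- An inverse system of finite-dimensional spaces is the dual of the direct system of dual spaces,
on which a vector is a functional. -/
theorem exists_compatible_vectors [∀ i, FiniteDimensional K (G i)] (hi₀ : IsBot i₀)
    (f : ∀ i j, i ≤ j → G j →ₗ[K] G i) [InverseSystem (F := G) fun i j h => f i j h] {v₀ : G i₀}
    (hv₀ : ∀ i, v₀ ∈ LinearMap.range (f i₀ i (hi₀ i))) :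
    ∃ v : ∀ i, G i, v i₀ = v₀ ∧ ∀ i j h, f i j h (v j) = v i := by
  have : DirectedSystem (fun i => Module.Dual K (G i)) (fun i j h => (f i j h).dualMap) := {
    map_self i φ := LinearMap.ext fun x =>
      congrArg φ (InverseSystem.map_self (f := fun i j h => f i j h) x)
    map_map i j k h h' φ := LinearMap.ext fun x =>
      congrArg φ (InverseSystem.map_map (f := fun i j h => f i j h) h h' x) }
  have hker : ∀ i, LinearMap.ker (f i₀ i (hi₀ i)).dualMap ≤
      LinearMap.ker (Module.evalEquiv K (G i₀) v₀) := by
    intro i φ hφ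
    obtain ⟨x, rfl⟩ := hv₀ i
    exact LinearMap.congr_fun hφ x
  obtain ⟨Φ, hΦ₀, hΦ⟩ := exists_compatible_functionals hi₀ (fun i j h => (f i j h).dualMap) hker
  choose v hv using fun i => (Module.evalEquiv K (G i)).surjective (Φ i)
  refine ⟨v, (Module.evalEquiv K _).injective ((hv i₀).trans hΦ₀), fun i j h => ?_⟩
  refine (Module.evalEquiv K _).injective ?_
  calc Module.evalEquiv K _ (f i j h (v j))
    _ = Module.evalEquiv K _ (v j) ∘ₗ (f i j h).dualMap := rfl
    _ = Module.evalEquiv K _ (v i) := by rw [hv, hΦ, hv]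

end CompatibleFamilies

noncomputable section IntervalModules

variable {K : Type u} [Field K] {P : Type} [PartialOrder P] {I : Set P}

theorem isInterval_of_directedOn (hI : I.OrdConnected) (hdir : DirectedOn (· ≤ ·) I) :
    IsInterval I where
  convex _ _ _ hx hy hxz hzy := hI.out hx hy ⟨hxz, hzy⟩
  connected x y := by
    obtain ⟨z, hz, hxz, hyz⟩ := hdir x x.2 y y.2
    exact .head (b := ⟨z, hz⟩) (.inl hxz) (.single (.inr hyz))

namespace PersistenceModule

variable (F : PersistenceModule K P)

/-- The value of a persistence module at a point. The notation `F.obj p` does not elaborate when `P`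
is a product of posets, where the product category structure is found instead of the order. -/
abbrev space (p : P) : ModuleCat.{u} K := F.obj p

/-- The structure map of a persistence module, as a linear map. -/
def transition {p q : P} (h : p ≤ q) : F.space p →ₗ[K] F.space q :=
  (F.map (homOfLE h)).hom

@[simp]
theorem transition_refl {p : P} (h : p ≤ p) : F.transition h = LinearMap.id := by
  ext; simp [transition]

@[simp]
theorem transition_transition {p q r : P} (h : p ≤ q) (h' : q ≤ r) (x : F.space p) :
    F.transition h' (F.transition h x) = F.transition (h.trans h') x := by
  simp [transition, ← ModuleCat.comp_apply, ← F.map_comp]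

theorem transition_comp {p q r : P} (h : p ≤ q) (h' : q ≤ r) :
    F.transition h' ∘ₗ F.transition h = F.transition (h.trans h') := by
  ext; simp

/-- A component of a morphism of persistence modules, as a linear map. -/
abbrev component {F G : PersistenceModule K P} (f : F ⟶ G) (p : P) : F.space p →ₗ[K] G.space p :=
  (f.app p).hom

theorem component_transition {F G : PersistenceModule K P} (f : F ⟶ G) {p q : P} (h : p ≤ q)
    (x : F.space p) : component f q (F.transition h x) = G.transition h (component f p x) :=
  LinearMap.congr_fun (congrArg ModuleCat.Hom.hom (f.naturality (homOfLE h))) x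

/-- Restriction of a persistence module along a monotone map. -/
abbrev comap {Q : Type} [PartialOrder Q] (σ : Q →o P) : PersistenceModule K Q :=
  σ.monotone.functor ⋙ F

/-- The morphism to the restriction along an inflationary map given by the structure maps. -/
def toComap (ρ : P →o P) (hρ : ∀ p, p ≤ ρ p) : F ⟶ F.comap ρ where
  app p := F.map (homOfLE (hρ p))
  naturality p q h := by
    rw [Functor.comp_map, ← F.map_comp, ← F.map_comp]
    rfl

/-- A persistence morphism from linear maps commuting with the structure maps. -/
def homMk {F G : PersistenceModule K P} (f : ∀ p, F.space p →ₗ[K] G.space p)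
    (hf : ∀ p q (h : p ≤ q), f q ∘ₗ F.transition h = G.transition h ∘ₗ f p) : F ⟶ G where
  app p := ModuleCat.ofHom (f p)
  naturality p q h := ModuleCat.hom_ext (hf p q (leOfHom h))

@[simp]
theorem homMk_app_hom {F G : PersistenceModule K P} (f : ∀ p, F.space p →ₗ[K] G.space p) (hf)
    (p : P) : ((homMk (F := F) (G := G) f hf).app p).hom = f p := rfl

end PersistenceModule

/-- The identification of the values of an interval module on the interval with the field. -/
def intervalModuleIso (hI : IsInterval I) {p : P} (hp : p ∈ I) :
    (intervalModule K hI).space p ≅ ModuleCat.of K K :=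
  eqToIso (if_pos hp)

theorem intervalModule_transition (hI : IsInterval I) {p q : P} (h : p ≤ q) (hp : p ∈ I)
    (hq : q ∈ I) : (intervalModule K hI).transition h =
      ((intervalModuleIso hI hp).hom ≫ (intervalModuleIso hI hq).inv).hom := by
  simp only [intervalModule, PersistenceModule.transition, hp, hq, homOfLE_leOfHom, and_self,
    ↓reduceDIte, ↓reduceIte, eqToHom_naturality, Category.comp_id, eqToHom_trans,
    intervalModuleIso, eqToIso.hom, eqToIso.inv]
  rfl

theorem isZero_intervalModule_space (hI : IsInterval I) {p : P} (hp : p ∉ I) :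
    IsZero ((intervalModule K hI).space p) := by
  have h : (intervalModule K hI).space p = ModuleCat.of K PUnit := if_neg hp
  exact h ▸ ModuleCat.isZero_of_subsingleton _

/-- Vectors `gen p` and functionals `coord p` on the spaces of a persistence module that behave
like the generator and the coordinate of an interval module of `I`. -/
structure IntervalFrame (F : PersistenceModule K P) (I : Set P) where
  gen : ∀ p, F.space p
  coord : ∀ p, Module.Dual K (F.space p)
  gen_eq_zero : ∀ p ∉ I, gen p = 0
  coord_eq_zero : ∀ p ∉ I, coord p = 0
  coord_gen : ∀ p ∈ I, coord p (gen p) = 1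
  map_gen : ∀ ⦃p q⦄ (h : p ≤ q), p ∈ I → F.transition h (gen p) = gen q
  coord_map : ∀ ⦃p q⦄ (h : p ≤ q), q ∈ I → coord q ∘ₗ F.transition h = coord p

namespace IntervalFrame

variable {F G : PersistenceModule K P}

/-- The morphism that sends `x` to its coordinate times the generator: it factors through the
interval module. -/
def hom (A : IntervalFrame F I) (B : IntervalFrame G I) : F ⟶ G :=
  PersistenceModule.homMk (fun p => (A.coord p).smulRight (B.gen p)) fun p q h => by
    ext x
    by_cases hp : p ∈ I
    · by_cases hq : q ∈ I
      · simp [B.map_gen h hp, ← A.coord_map h hq]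
      · simp [B.map_gen h hp, B.gen_eq_zero q hq]
    · by_cases hq : q ∈ I
      · simp [A.coord_eq_zero p hp, ← LinearMap.comp_apply, A.coord_map h hq]
      · simp [A.coord_eq_zero p hp, A.coord_eq_zero q hq]

/-- Restriction of an interval frame along a monotone map. -/
def comap {Q : Type} [PartialOrder Q] (A : IntervalFrame F I) (σ : Q →o P) :
    IntervalFrame (F.comap σ) (σ ⁻¹' I) where
  gen q := A.gen (σ q)
  coord q := A.coord (σ q)
  gen_eq_zero q := A.gen_eq_zero (σ q)
  coord_eq_zero q := A.coord_eq_zero (σ q)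
  coord_gen q := A.coord_gen (σ q)
  map_gen _ _ h := A.map_gen (σ.monotone h)
  coord_map _ _ h := A.coord_map (σ.monotone h)

theorem hom_comp_hom {H : PersistenceModule K P} (A : IntervalFrame F I) (B : IntervalFrame G I)
    (C : IntervalFrame H I) : A.hom B ≫ B.hom C = A.hom C := by
  ext p x
  by_cases hp : p ∈ I
  · simp [hom, B.coord_gen p hp]
  · simp [hom, A.coord_eq_zero p hp]

open Classical in
/-- The tautological interval frame of an interval module. -/
def ofIntervalModule (hI : IsInterval I) : IntervalFrame (intervalModule K hI) I where
  gen p := if hp : p ∈ I then (intervalModuleIso hI hp).inv.hom (1 : K) else 0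
  coord p := if hp : p ∈ I then (intervalModuleIso hI hp).hom.hom else 0
  gen_eq_zero p hp := by simp [hp]
  coord_eq_zero p hp := by simp [hp]
  coord_gen p hp := by simp [hp]
  map_gen p q h hp := by
    by_cases hq : q ∈ I
    · simp [hp, hq, intervalModule_transition hI h hp hq]
    · exact (ModuleCat.subsingleton_of_isZero (isZero_intervalModule_space hI hq)).elim _ _
  coord_map p q h hq := by
    by_cases hp : p ∈ I
    · ext x
      simp [hp, hq, intervalModule_transition hI h hp hq]
    · have := ModuleCat.subsingleton_of_isZero (isZero_intervalModule_space (K := K) hI hp)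
      exact Subsingleton.elim _ _

theorem ofIntervalModule_hom_self (hI : IsInterval I) :
    (ofIntervalModule (K := K) hI).hom (ofIntervalModule hI) = 𝟙 _ := by
  ext p x
  by_cases hp : p ∈ I
  · change (ofIntervalModule hI).coord p x • (ofIntervalModule hI).gen p = x
    simp only [ofIntervalModule, hp, dite_true]
    rw [← map_smul]
    simp
  · exact (ModuleCat.subsingleton_of_isZero (isZero_intervalModule_space (K := K) hI hp)).elim _ _

/-- The interval module as a retract of a persistence module with an interval frame. -/
def retract (A : IntervalFrame F I) (hI : IsInterval I) : Retract (intervalModule K hI) F where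
  i := (ofIntervalModule hI).hom A
  r := A.hom (ofIntervalModule hI)
  retract := by rw [hom_comp_hom, ofIntervalModule_hom_self]

end IntervalFrame

open IntervalFrame in
theorem not_isZero_intervalModule (hI : IsInterval I) (hne : I.Nonempty) :
    ¬ IsZero (intervalModule K hI) := by
  intro h
  obtain ⟨p, hp⟩ := hne
  have hid : 𝟙 (intervalModule K hI) = 0 := (IsZero.iff_id_eq_zero _).1 h
  have hgen : (ofIntervalModule (K := K) hI).gen p = 0 :=
    LinearMap.congr_fun (congrArg (fun f => PersistenceModule.component f p) hid) _
  simpa [hgen] using (ofIntervalModule (K := K) hI).coord_gen p hp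

end IntervalModules

section Retracts

variable {K : Type u} [Field K] {P : Type} [PartialOrder P] {F G : PersistenceModule K P}

namespace PersistenceModule

theorem exists_nontrivial_of_not_isZero (hF : ¬ IsZero F) : ∃ p, Nontrivial (F.space p) := by
  contrapose! hF
  exact F.isZero fun p => have := hF p; ModuleCat.isZero_of_subsingleton _

theorem retract_app (r : Retract G F) (p : P) (x : G.space p) :
    component r.r p (component r.i p x) = x :=
  LinearMap.congr_fun (congrArg (fun f => component f p) r.retract) x

theorem nonempty_retract_of_bijective_prod {A B : PersistenceModule K P} (f : F ⟶ A) (g : F ⟶ B)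
    (h : ∀ p, Function.Bijective ((component f p).prod (component g p))) :
    Nonempty (Retract A F) := by
  let e (p : P) : F.space p ≃ₗ[K] A.space p × B.space p := .ofBijective _ (h p)
  let i (p : P) : A.space p →ₗ[K] F.space p := (e p).symm.toLinearMap ∘ₗ .inl K _ _
  have he (p : P) (a : A.space p) : e p (i p a) = (a, 0) := (e p).apply_symm_apply _
  have hf (p : P) (a : A.space p) : component f p (i p a) = a := congrArg Prod.fst (he p a)
  have hg (p : P) (a : A.space p) : component g p (i p a) = 0 := congrArg Prod.snd (he p a)
  refine ⟨⟨homMk i fun p q hpq => LinearMap.ext fun a => (e q).injective (Prod.ext ?_ ?_), f, ?_⟩⟩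
  · exact (hf q _).trans (by simp [e, component_transition, hf])
  · exact (hg q _).trans (by simp [e, component_transition, hg])
  · ext p a
    exact hf p a

end PersistenceModule

open PersistenceModule in
theorem IsPointwiseFiniteDimensional.of_retract (hF : IsPointwiseFiniteDimensional F)
    (r : Retract G F) : IsPointwiseFiniteDimensional G := fun p =>
  have := hF p
  .of_injective (component r.i p) (Function.LeftInverse.injective (retract_app r p))

theorem IsPointwiseFiniteDimensional.comap {Q : Type} [PartialOrder Q]
    (hF : IsPointwiseFiniteDimensional F) (σ : Q →o P) :
    IsPointwiseFiniteDimensional (F.comap σ) := fun q =>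
  hF (σ q)

end Retracts

section Lifespan

variable {K : Type u} [Field K] {P : Type} [PartialOrder P] {F : PersistenceModule K P} {p₀ : P}

namespace PersistenceModule

theorem monotone_range_transition {p q : P} (h : p ≤ q) (h' : q ≤ p₀) :
    LinearMap.range (F.transition (h.trans h')) ≤ LinearMap.range (F.transition h') := by
  rw [← F.transition_comp h h']
  exact LinearMap.range_comp_le_range _ _

theorem monotone_ker_transition {p q : P} (h : p₀ ≤ p) (h' : p ≤ q) :
    LinearMap.ker (F.transition h) ≤ LinearMap.ker (F.transition (h.trans h')) := by
  rw [← F.transition_comp h h']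
  exact LinearMap.ker_le_ker_comp _ _

/-- The points of `P` comparable to `p₀` at which a vector of `F` at `p₀` lives: those below `p₀`
from which it comes and those above `p₀` at which it is not yet zero. -/
def lifespan (v : F.space p₀) : Set P :=
  {p | (∃ h : p ≤ p₀, v ∈ LinearMap.range (F.transition h)) ∨
    ∃ h : p₀ ≤ p, v ∉ LinearMap.ker (F.transition h)}

variable {v : F.space p₀} {p : P}

theorem mem_lifespan_of_le (h : p ≤ p₀) :
    p ∈ lifespan v ↔ v ∈ LinearMap.range (F.transition h) := by
  refine ⟨?_, fun hp => .inl ⟨h, hp⟩⟩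
  rintro (⟨_, hp⟩ | ⟨h', _⟩)
  · exact hp
  · obtain rfl := h.antisymm h'
    simp

theorem mem_lifespan_of_ge (hv : v ≠ 0) (h : p₀ ≤ p) :
    p ∈ lifespan v ↔ v ∉ LinearMap.ker (F.transition h) := by
  refine ⟨?_, fun hp => .inr ⟨h, hp⟩⟩
  rintro (⟨h', _⟩ | ⟨_, hp⟩)
  · obtain rfl := h'.antisymm h
    simpa using hv
  · exact hp

theorem self_mem_lifespan : p₀ ∈ lifespan v :=
  (mem_lifespan_of_le le_rfl).2 (by simp)

theorem ordConnected_lifespan (hcomp : ∀ p, p ≤ p₀ ∨ p₀ ≤ p) (hv : v ≠ 0) :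
    (lifespan v).OrdConnected := by
  refine ⟨fun x hx y hy z ⟨hxz, hzy⟩ => ?_⟩
  rcases hcomp z with h | h
  · rw [mem_lifespan_of_le (hxz.trans h)] at hx
    exact (mem_lifespan_of_le h).2 (monotone_range_transition hxz h hx)
  · rw [mem_lifespan_of_ge hv (h.trans hzy)] at hy
    exact (mem_lifespan_of_ge hv h).2 fun hz => hy (monotone_ker_transition h hzy hz)

theorem exists_gen_of_directedOn_lifespan (hcomp : ∀ p, p ≤ p₀ ∨ p₀ ≤ p)
    (hfin : IsPointwiseFiniteDimensional F) (hv : v ≠ 0)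
    (hdir : DirectedOn (· ≥ ·) (lifespan v)) :
    ∃ gen : ∀ p, F.space p, gen p₀ = v ∧ (∀ p ∉ lifespan v, gen p = 0) ∧
      ∀ p q (h : p ≤ q), p ∈ lifespan v → F.transition h (gen p) = gen q := by
  classical
  let D := {p // p ∈ lifespan v ∧ p ≤ p₀}
  have : IsDirectedOrder Dᵒᵈ := ⟨fun a b => by
    obtain ⟨c, hc, hac, hbc⟩ := hdir _ a.ofDual.2.1 _ b.ofDual.2.1
    exact ⟨.toDual ⟨c, hc, le_trans hac a.ofDual.2.2⟩, hac, hbc⟩⟩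
  have (p : P) : FiniteDimensional K (F.space p) := hfin p
  let f (a b : Dᵒᵈ) (h : a ≤ b) := F.transition (show b.ofDual.1 ≤ a.ofDual.1 from h)
  have : InverseSystem fun a b h => f a b h := ⟨by simp [f], by simp [f]⟩
  obtain ⟨w, hw₀, hw⟩ := exists_compatible_vectors (i₀ := .toDual ⟨p₀, self_mem_lifespan, le_rfl⟩)
    (fun a => a.ofDual.2.2) f fun a => (mem_lifespan_of_le _).1 a.ofDual.2.1
  let g (p : P) (hp : p ∈ lifespan v ∧ p ≤ p₀) : F.space p := w (.toDual ⟨p, hp⟩)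
  have hg (p q) (h : p ≤ q) (hp) (hq) : F.transition h (g p hp) = g q hq :=
    hw (.toDual ⟨q, hq⟩) (.toDual ⟨p, hp⟩) h
  refine ⟨fun p => if h : p₀ ≤ p then F.transition h v else
    if hp : p ∈ lifespan v ∧ p ≤ p₀ then g p hp else 0, by simp, ?_, ?_⟩
  · intro p hp
    by_cases h : p₀ ≤ p
    · simpa [h] using not_imp_comm.1 (mem_lifespan_of_ge hv h).2 hp
    · simp [h, hp]
  · intro p q h hp
    by_cases hp₀ : p₀ ≤ p
    · simp [hp₀, hp₀.trans h]
    have hp' : p ∈ lifespan v ∧ p ≤ p₀ := ⟨hp, (hcomp p).resolve_right hp₀⟩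
    by_cases hq₀ : p₀ ≤ q
    · have hgv : F.transition hp'.2 (g p hp') = v :=
        (hg p p₀ hp'.2 hp' ⟨self_mem_lifespan, le_rfl⟩).trans hw₀
      simp [hp₀, hq₀, hp', ← F.transition_transition hp'.2 hq₀, hgv]
    · have hqp₀ := (hcomp q).resolve_right hq₀
      have hq := (ordConnected_lifespan hcomp hv).out hp self_mem_lifespan ⟨h, hqp₀⟩
      simp [hp₀, hq₀, hp', hq, hqp₀, hg p q h]

theorem exists_coord_of_directedOn_lifespan (hcomp : ∀ p, p ≤ p₀ ∨ p₀ ≤ p)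
    {φ : Module.Dual K (F.space p₀)} (hφ : φ v = 1)
    (hker : ∀ p (h : p₀ ≤ p), IsAdapted v φ (LinearMap.ker (F.transition h)))
    (hrange : ∀ p (h : p ≤ p₀), IsAdapted v φ (LinearMap.range (F.transition h)))
    (hdir : DirectedOn (· ≤ ·) (lifespan v)) :
    ∃ coord : ∀ p, Module.Dual K (F.space p), coord p₀ = φ ∧ (∀ p ∉ lifespan v, coord p = 0) ∧
      ∀ p q (h : p ≤ q), q ∈ lifespan v → coord q ∘ₗ F.transition h = coord p := by
  classical
  have hv : v ≠ 0 := fun hv => by simp [hv] at hφ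
  let D := {p // p ∈ lifespan v ∧ p₀ ≤ p}
  have : IsDirectedOrder D := ⟨fun a b => by
    obtain ⟨c, hc, hac, hbc⟩ := hdir _ a.2.1 _ b.2.1
    exact ⟨⟨c, hc, le_trans a.2.2 hac⟩, hac, hbc⟩⟩
  let f (a b : D) (h : a ≤ b) := F.transition (show a.1 ≤ b.1 from h)
  have : DirectedSystem (fun a : D => F.space a.1) fun a b h => f a b h :=
    ⟨by simp [f], by simp [f]⟩
  obtain ⟨ψ, hψ₀, hψ⟩ := exists_compatible_functionals (i₀ := ⟨p₀, self_mem_lifespan, le_rfl⟩)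
    (fun a : D => a.2.2) f fun a => ((hker _ a.2.2).le_ker_iff hφ).2
      ((mem_lifespan_of_ge hv a.2.2).1 a.2.1)
  refine ⟨fun p => if h : p ≤ p₀ then φ ∘ₗ F.transition h else
    if hp : p ∈ lifespan v ∧ p₀ ≤ p then ψ ⟨p, hp⟩ else 0, by simp, ?_, ?_⟩
  · intro p hp
    by_cases h : p ≤ p₀
    · rw [mem_lifespan_of_le h, ← (hrange p h).le_ker_iff hφ, LinearMap.range_le_ker_iff] at hp
      simpa [h] using hp
    · simp [h, hp]
  · intro p q h hq
    by_cases hq₀ : q ≤ p₀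
    · simp [hq₀, h.trans hq₀, LinearMap.comp_assoc, transition_comp]
    have hq' : q ∈ lifespan v ∧ p₀ ≤ q := ⟨hq, (hcomp q).resolve_left hq₀⟩
    by_cases hp₀ : p ≤ p₀
    · have := hψ ⟨p₀, self_mem_lifespan, le_rfl⟩ ⟨q, hq'⟩ hq'.2
      simp [hp₀, hq₀, hq', ← hψ₀, ← this, f, LinearMap.comp_assoc, transition_comp]
    · have hp₀p := (hcomp p).resolve_left hp₀
      have hp' : p ∈ lifespan v ∧ p₀ ≤ p :=
        ⟨(ordConnected_lifespan hcomp hv).out self_mem_lifespan hq ⟨hp₀p, h⟩, hp₀p⟩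
      simpa [hp₀, hq₀, hp', hq'] using hψ ⟨p, hp'⟩ ⟨q, hq'⟩ h

end PersistenceModule

open PersistenceModule

theorem nonempty_intervalFrame_lifespan (hfin : IsPointwiseFiniteDimensional F)
    (hcomp : ∀ p, p ≤ p₀ ∨ p₀ ≤ p) {v : F.space p₀} {φ : Module.Dual K (F.space p₀)} (hφ : φ v = 1)
    (hker : ∀ p (h : p₀ ≤ p), IsAdapted v φ (LinearMap.ker (F.transition h)))
    (hrange : ∀ p (h : p ≤ p₀), IsAdapted v φ (LinearMap.range (F.transition h)))
    (hdir : DirectedOn (· ≤ ·) (lifespan v)) (hcodir : DirectedOn (· ≥ ·) (lifespan v)) :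
    Nonempty (IntervalFrame F (lifespan v)) := by
  have hv : v ≠ 0 := fun hv => by simp [hv] at hφ
  obtain ⟨gen, gen_p₀, gen_eq_zero, map_gen⟩ :=
    exists_gen_of_directedOn_lifespan hcomp hfin hv hcodir
  obtain ⟨coord, coord_p₀, coord_eq_zero, coord_map⟩ :=
    exists_coord_of_directedOn_lifespan hcomp hφ hker hrange hdir
  refine ⟨⟨gen, coord, gen_eq_zero, coord_eq_zero, fun p hp => ?_, map_gen, coord_map⟩⟩
  rcases hcomp p with h | h
  · rw [← coord_map _ _ h self_mem_lifespan, LinearMap.comp_apply, map_gen _ _ h hp, coord_p₀,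
      gen_p₀, hφ]
  · rw [← map_gen _ _ h self_mem_lifespan, ← LinearMap.comp_apply, coord_map _ _ h hp, coord_p₀,
      gen_p₀, hφ]

end Lifespan

section LinearOrder

open PersistenceModule

theorem exists_intervalFrame_of_linearOrder {K : Type u} [Field K] {L : Type} [LinearOrder L]
    {M : PersistenceModule K L} (hfin : IsPointwiseFiniteDimensional M) {s₀ : L}
    [Nontrivial (M.space s₀)] :
    ∃ J : Set L, J.OrdConnected ∧ J.Nonempty ∧ Nonempty (IntervalFrame M J) := by
  have := hfin s₀
  have hrange : Monotone fun s : Set.Iic s₀ => LinearMap.range (M.transition s.2) :=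
    fun _ s h => monotone_range_transition (Subtype.coe_le_coe.2 h) s.2
  have hker : Monotone fun s : Set.Ici s₀ => LinearMap.ker (M.transition s.2) :=
    fun s _ h => monotone_ker_transition s.2 (Subtype.coe_le_coe.2 h)
  obtain ⟨v, φ, hφ, hvφ⟩ := exists_isAdapted_of_isChain hrange.isChain_range hker.isChain_range
  have hv : v ≠ 0 := fun hv => by simp [hv] at hφ
  have hcomp (s : L) := le_total s s₀
  refine ⟨lifespan v, ordConnected_lifespan hcomp hv, ⟨s₀, self_mem_lifespan⟩, ?_⟩
  exact nonempty_intervalFrame_lifespan hfin hcomp hφ (fun s h => hvφ _ (.inr ⟨⟨s, h⟩, rfl⟩))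
    (fun s h => hvφ _ (.inl ⟨⟨s, h⟩, rfl⟩)) (Std.Total.directedOn _) (Std.Total.directedOn _)

end LinearOrder

section Product

variable {K : Type u} [Field K] {S T : Type}

namespace PersistenceModule

section PartialOrder

variable [PartialOrder S] [PartialOrder T] (F : PersistenceModule K (S × T))

/-- The structure map along an inequality in the first factor. -/
abbrev mapFst {s s' : S} (hs : s ≤ s') (t : T) : F.space (s, t) →ₗ[K] F.space (s', t) :=
  F.transition (Prod.mk_le_mk_iff_left.2 hs)

/-- The structure map along an inequality in the second factor. -/
abbrev mapSnd (s : S) {t t' : T} (ht : t ≤ t') : F.space (s, t) →ₗ[K] F.space (s, t') :=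
  F.transition (Prod.mk_le_mk_iff_right.2 ht)

/-- A bipersistence module is weakly cartesian if it sends the rectangles of `S × T` to weak
pullback squares. Unlike middle-exactness, this only refers to the elements of its spaces. -/
def IsWeaklyCartesian : Prop :=
  ∀ ⦃s s' : S⦄ (hs : s ≤ s') ⦃t t' : T⦄ (ht : t ≤ t') (x : F.space (s', t)) (y : F.space (s, t')),
    F.mapSnd s' ht x = F.mapFst hs t' y →
      ∃ z : F.space (s, t), F.mapFst hs t z = x ∧ F.mapSnd s ht z = y

variable {F}

theorem IsWeaklyCartesian.of_retract {G : PersistenceModule K (S × T)} (hF : F.IsWeaklyCartesian)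
    (r : Retract G F) : G.IsWeaklyCartesian := by
  intro s s' hs t t' ht x y hxy
  obtain ⟨z, hzx, hzy⟩ := hF hs ht (component r.i _ x) (component r.i _ y) (by
    rw [← component_transition, ← component_transition, hxy])
  refine ⟨component r.r _ z, ?_, ?_⟩
  · rw [← component_transition, hzx, retract_app]
  · rw [← component_transition, hzy, retract_app]

variable {s s' : S} {t t' : T}

theorem IsWeaklyCartesian.ker_transition (hF : F.IsWeaklyCartesian) (h : (s, t) ≤ (s', t')) :
    LinearMap.ker (F.transition h) =
      LinearMap.ker (F.mapFst h.1 t) ⊔ LinearMap.ker (F.mapSnd s h.2) := by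
  refine le_antisymm (fun x hx => ?_) (sup_le
    (monotone_ker_transition (Prod.mk_le_mk_iff_left.2 h.1) (Prod.mk_le_mk_iff_right.2 h.2))
    (monotone_ker_transition (Prod.mk_le_mk_iff_right.2 h.2) (Prod.mk_le_mk_iff_left.2 h.1)))
  obtain ⟨z, hz₁, hz₂⟩ := hF h.1 h.2 (F.mapFst h.1 t x) 0 (by simpa using hx)
  refine Submodule.mem_sup.2 ⟨x - z, ?_, z, hz₂, sub_add_cancel x z⟩
  rw [LinearMap.mem_ker, map_sub, hz₁, sub_self]

theorem IsWeaklyCartesian.range_transition (hF : F.IsWeaklyCartesian) (h : (s, t) ≤ (s', t')) :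
    LinearMap.range (F.transition h) =
      LinearMap.range (F.mapFst h.1 t') ⊓ LinearMap.range (F.mapSnd s' h.2) := by
  refine le_antisymm (le_inf
    (monotone_range_transition (Prod.mk_le_mk_iff_right.2 h.2) (Prod.mk_le_mk_iff_left.2 h.1))
    (monotone_range_transition (Prod.mk_le_mk_iff_left.2 h.1) (Prod.mk_le_mk_iff_right.2 h.2))) ?_
  rintro _ ⟨⟨y, rfl⟩, x, hxy⟩
  obtain ⟨z, -, rfl⟩ := hF h.1 h.2 x y hxy
  exact ⟨z, by simp⟩

end PartialOrder

end PersistenceModule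

theorem MiddleExactSquare.exists_lift {𝒜 : Type*} [Category 𝒜] [Abelian 𝒜] {A B C D : 𝒜}
    {α : A ⟶ B} {f : A ⟶ C} {g : B ⟶ D} {β : C ⟶ D} {sq : CommSq α f g β}
    (h : MiddleExactSquare sq) {P : 𝒜} [Projective P] (b : P ⟶ B) (c : P ⟶ C)
    (hbc : b ≫ g = c ≫ β) : ∃ a : P ⟶ A, a ≫ α = b ∧ a ≫ f = c := by
  have hzero : biprod.lift b c ≫ biprod.desc g (-β) = 0 := by simp [hbc]
  have hlift := h.liftFromProjective_comp (biprod.lift b c) hzero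
  refine ⟨h.liftFromProjective (biprod.lift b c) hzero, ?_, ?_⟩
  · simpa using hlift =≫ biprod.fst
  · simpa using hlift =≫ biprod.snd

open PersistenceModule in
theorem MiddleExactSquare.exists_transition_eq {P : Type} [Lattice P] {F : PersistenceModule K P}
    {p q : P} (h : MiddleExactSquare (F.infSupSquare p q)) (x : F.space p) (y : F.space q)
    (hxy : F.transition le_sup_left x = F.transition le_sup_right y) :
    ∃ z, F.transition inf_le_left z = x ∧ F.transition inf_le_right z = y := by
  obtain ⟨a, hax, hay⟩ := h.exists_lift
    (ModuleCat.ofHom (LinearMap.toSpanSingleton K (F.space p) x))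
    (ModuleCat.ofHom (LinearMap.toSpanSingleton K (F.space q) y))
    (ModuleCat.hom_ext (LinearMap.ext_ring (by simpa [transition] using hxy)))
  refine ⟨a.hom (1 : K), ?_, ?_⟩
  · simpa [transition] using congrArg (fun f => f.hom (1 : K)) hax
  · simpa [transition] using congrArg (fun f => f.hom (1 : K)) hay

theorem IsMiddleExact.isWeaklyCartesian [LinearOrder S] [LinearOrder T]
    {F : PersistenceModule K (S × T)} (hF : IsMiddleExact F) : F.IsWeaklyCartesian := by
  intro s s' hs t t' ht x y hxy
  have key {m p q j : S × T} (hm : m = p ⊓ q) (hj : j = p ⊔ q) (hmp : m ≤ p) (hmq : m ≤ q)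
      (hpj : p ≤ j) (hqj : q ≤ j) (x : F.space p) (y : F.space q)
      (hxy : F.transition hpj x = F.transition hqj y) :
      ∃ z, F.transition hmp z = x ∧ F.transition hmq z = y := by
    subst hm hj
    exact (hF p q).exists_transition_eq x y hxy
  exact key (by simp [hs, ht]) (by simp [hs, ht]) _ _ _ _ x y hxy

end Product

section Blocks

open PersistenceModule

variable {K : Type u} [Field K] {S T : Type} [LinearOrder S] [LinearOrder T]
  {F : PersistenceModule K (S × T)}

theorem exists_isLowerSet_intervalFrame [OrderBot S] [OrderBot T]
    (hfin : IsPointwiseFiniteDimensional F) (hF : F.IsWeaklyCartesian)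
    [Nontrivial (F.space (⊥, ⊥))] :
    ∃ (J₁ : Set S) (J₂ : Set T), IsLowerSet J₁ ∧ IsLowerSet J₂ ∧ (J₁ ×ˢ J₂).Nonempty ∧
      Nonempty (IntervalFrame F (J₁ ×ˢ J₂)) := by
  have := hfin (⊥, ⊥)
  have hker₁ : Monotone fun s : S => LinearMap.ker (F.mapFst (bot_le (a := s)) ⊥) :=
    fun s _ h => monotone_ker_transition _ (Prod.mk_le_mk_iff_left.2 h)
  have hker₂ : Monotone fun t : T => LinearMap.ker (F.mapSnd ⊥ (bot_le (a := t))) :=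
    fun t _ h => monotone_ker_transition _ (Prod.mk_le_mk_iff_right.2 h)
  obtain ⟨v, φ, hφ, hvφ⟩ := exists_isAdapted_of_isChain hker₁.isChain_range hker₂.isChain_range
  have hv : v ≠ 0 := fun hv => by simp [hv] at hφ
  have hadapt₁ (s : S) : IsAdapted v φ (LinearMap.ker (F.mapFst bot_le ⊥)) := hvφ _ (.inl ⟨s, rfl⟩)
  have hadapt₂ (t : T) : IsAdapted v φ (LinearMap.ker (F.mapSnd ⊥ bot_le)) := hvφ _ (.inr ⟨t, rfl⟩)
  have hcomp (p : S × T) : p ≤ (⊥, ⊥) ∨ (⊥, ⊥) ≤ p := .inr bot_le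
  let J₁ := {s : S | v ∉ LinearMap.ker (F.mapFst (bot_le (a := s)) ⊥)}
  let J₂ := {t : T | v ∉ LinearMap.ker (F.mapSnd ⊥ (bot_le (a := t)))}
  have hJ : lifespan v = J₁ ×ˢ J₂ := by
    ext p
    rw [mem_lifespan_of_ge hv bot_le, hF.ker_transition,
      (hadapt₁ p.1).mem_sup_iff (hadapt₂ p.2) hφ, not_or]
    rfl
  refine ⟨J₁, J₂, fun s s' h hs hs' => hs (hker₁ h hs'), fun t t' h ht ht' => ht (hker₂ h ht'),
    hJ ▸ ⟨_, self_mem_lifespan⟩, hJ ▸ nonempty_intervalFrame_lifespan hfin hcomp hφ ?_ ?_ ?_ ?_⟩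
  · intro p h
    rw [hF.ker_transition]
    exact (hadapt₁ _).sup (hadapt₂ _)
  · intro p h
    obtain rfl := le_bot_iff.1 h
    exact .inl (by simp)
  · exact hJ ▸ ((LinearOrder.supClosed J₁).prod (LinearOrder.supClosed J₂)).directedOn
  · exact hJ ▸ ((LinearOrder.infClosed J₁).prod (LinearOrder.infClosed J₂)).codirectedOn

theorem exists_isUpperSet_intervalFrame [OrderTop S] [OrderTop T]
    (hfin : IsPointwiseFiniteDimensional F) (hF : F.IsWeaklyCartesian)
    [Nontrivial (F.space (⊤, ⊤))] :
    ∃ (J₁ : Set S) (J₂ : Set T), IsUpperSet J₁ ∧ IsUpperSet J₂ ∧ (J₁ ×ˢ J₂).Nonempty ∧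
      Nonempty (IntervalFrame F (J₁ ×ˢ J₂)) := by
  have := hfin (⊤, ⊤)
  have hrange₁ : Monotone fun s : S => LinearMap.range (F.mapFst (le_top (a := s)) ⊤) :=
    fun _ s h => monotone_range_transition (Prod.mk_le_mk_iff_left.2 h) _
  have hrange₂ : Monotone fun t : T => LinearMap.range (F.mapSnd ⊤ (le_top (a := t))) :=
    fun _ t h => monotone_range_transition (Prod.mk_le_mk_iff_right.2 h) _
  obtain ⟨v, φ, hφ, hvφ⟩ := exists_isAdapted_of_isChain hrange₁.isChain_range hrange₂.isChain_range
  have hadapt₁ (s : S) : IsAdapted v φ (LinearMap.range (F.mapFst le_top ⊤)) :=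
    hvφ _ (.inl ⟨s, rfl⟩)
  have hadapt₂ (t : T) : IsAdapted v φ (LinearMap.range (F.mapSnd ⊤ le_top)) :=
    hvφ _ (.inr ⟨t, rfl⟩)
  have hcomp (p : S × T) : p ≤ (⊤, ⊤) ∨ (⊤, ⊤) ≤ p := .inl le_top
  let J₁ := {s : S | v ∈ LinearMap.range (F.mapFst (le_top (a := s)) ⊤)}
  let J₂ := {t : T | v ∈ LinearMap.range (F.mapSnd ⊤ (le_top (a := t)))}
  have hJ : lifespan v = J₁ ×ˢ J₂ := by
    ext p
    rw [mem_lifespan_of_le le_top, hF.range_transition]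
    rfl
  refine ⟨J₁, J₂, fun s s' h hs => hrange₁ h hs, fun t t' h ht => hrange₂ h ht,
    hJ ▸ ⟨_, self_mem_lifespan⟩, hJ ▸ nonempty_intervalFrame_lifespan hfin hcomp hφ ?_ ?_ ?_ ?_⟩
  · intro p h
    obtain rfl := top_le_iff.1 h
    exact .inr (by simp)
  · intro p h
    rw [hF.range_transition]
    exact (hadapt₁ _).inf (hadapt₂ _)
  · exact hJ ▸ ((LinearOrder.supClosed J₁).prod (LinearOrder.supClosed J₂)).directedOn
  · exact hJ ▸ ((LinearOrder.infClosed J₁).prod (LinearOrder.infClosed J₂)).codirectedOn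

namespace PersistenceModule.IsWeaklyCartesian

variable [BoundedOrder S] [BoundedOrder T]

/-- An element killed in both directions comes from the bottom corner, and a pair of elements on the
two top edges glues because it agrees at the top corner. -/
theorem bijective_prod_of_subsingleton (hF : F.IsWeaklyCartesian)
    [Subsingleton (F.space (⊥, ⊥))] [Subsingleton (F.space (⊤, ⊤))] (s : S) (t : T) :
    Function.Bijective ((F.mapSnd s (le_top (a := t))).prod (F.mapFst (le_top (a := s)) t)) := by
  constructor
  · rw [injective_iff_map_eq_zero]
    intro x hx
    obtain ⟨hx₂, hx₁⟩ := Prod.ext_iff.1 hx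
    obtain ⟨y, rfl, -⟩ := hF (bot_le (a := s)) (le_top (a := t)) x 0 (by simpa using hx₂)
    obtain ⟨z, -, rfl⟩ := hF (le_top (a := ⊥)) (bot_le (a := t)) 0 y (by simpa using hx₁.symm)
    simp [Subsingleton.elim z 0]
  · rintro ⟨y, x⟩
    obtain ⟨z, hzx, hzy⟩ := hF le_top le_top x y (Subsingleton.elim _ _)
    exact ⟨z, Prod.ext hzy hzx⟩

theorem nonempty_retract_comap_top (hF : F.IsWeaklyCartesian)
    [Subsingleton (F.space (⊥, ⊥))] [Subsingleton (F.space (⊤, ⊤))] :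
    Nonempty (Retract ((F.comap (.prod .id (.const S ⊤))).comap .fst) F) ∧
      Nonempty (Retract ((F.comap (.prod (.const T ⊤) .id)).comap .snd) F) := by
  let f : F ⟶ (F.comap (.prod .id (.const S ⊤))).comap .fst :=
    F.toComap ((OrderHom.prod .id (.const S ⊤)).comp .fst) fun _ => ⟨le_rfl, le_top⟩
  let g : F ⟶ (F.comap (.prod (.const T ⊤) .id)).comap .snd :=
    F.toComap ((OrderHom.prod (.const T ⊤) .id).comp .snd) fun _ => ⟨le_top, le_rfl⟩
  have hfg (p : S × T) : Function.Bijective ((component f p).prod (component g p)) :=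
    hF.bijective_prod_of_subsingleton p.1 p.2
  refine ⟨nonempty_retract_of_bijective_prod f g hfg,
    nonempty_retract_of_bijective_prod g f fun p => ?_⟩
  exact (LinearEquiv.prodComm K _ _).bijective.comp (hfg p)

end PersistenceModule.IsWeaklyCartesian

/-- The blocks of a product of linear orders: a block of `[0, ∞]²` is one of these sets, with
death, birth, vertical and horizontal blocks in this order. -/
inductive IsProductBlock : Set (S × T) → Prop
  | death {J₁ J₂} (h₁ : IsLowerSet J₁) (h₂ : IsLowerSet J₂) : IsProductBlock (J₁ ×ˢ J₂)
  | birth {J₁ J₂} (h₁ : IsUpperSet J₁) (h₂ : IsUpperSet J₂) : IsProductBlock (J₁ ×ˢ J₂)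
  | vertical {J} (h : J.OrdConnected) : IsProductBlock (J ×ˢ Set.univ)
  | horizontal {J} (h : J.OrdConnected) : IsProductBlock (Set.univ ×ˢ J)

theorem isInterval_prod {J₁ : Set S} {J₂ : Set T} (h₁ : J₁.OrdConnected) (h₂ : J₂.OrdConnected) :
    IsInterval (J₁ ×ˢ J₂) :=
  isInterval_of_directedOn
    ⟨fun _ hx _ hy _ hz =>
      ⟨h₁.out hx.1 hy.1 ⟨hz.1.1, hz.2.1⟩, h₂.out hx.2 hy.2 ⟨hz.1.2, hz.2.2⟩⟩⟩
    ((LinearOrder.supClosed J₁).prod (LinearOrder.supClosed J₂)).directedOn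

theorem IsProductBlock.isInterval {I : Set (S × T)} (hI : IsProductBlock I) : IsInterval I := by
  cases hI with
  | death h₁ h₂ => exact isInterval_prod h₁.ordConnected h₂.ordConnected
  | birth h₁ h₂ => exact isInterval_prod h₁.ordConnected h₂.ordConnected
  | vertical h => exact isInterval_prod h Set.ordConnected_univ
  | horizontal h => exact isInterval_prod Set.ordConnected_univ h

theorem IsProductBlock.isBlock {I : Set (ℝ≥0∞ × ℝ≥0∞)} (hI : IsProductBlock I) : IsBlock I where
  isInterval := hI.isInterval
  cases := by
    have isInterval {J : Set ℝ≥0∞} (h : J.OrdConnected) : IsInterval J :=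
      isInterval_of_directedOn h (Std.Total.directedOn J)
    cases hI with
    | death h₁ h₂ => exact .inl ⟨_, _, h₁, h₂, rfl⟩
    | birth h₁ h₂ => exact .inr (.inl ⟨_, _, h₁, h₂, rfl⟩)
    | vertical h => exact .inr (.inr (.inl ⟨_, isInterval h, rfl⟩))
    | horizontal h => exact .inr (.inr (.inr ⟨_, isInterval h, rfl⟩))

theorem exists_isProductBlock_retract [BoundedOrder S] [BoundedOrder T]
    (hfin : IsPointwiseFiniteDimensional F) (hF : F.IsWeaklyCartesian) (hF₀ : ¬ IsZero F) :
    ∃ (I : Set (S × T)) (hI : IsProductBlock I), I.Nonempty ∧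
      Nonempty (Retract (intervalModule K hI.isInterval) F) := by
  rcases subsingleton_or_nontrivial (F.space (⊥, ⊥)) with hbot | hbot
  case inr =>
    obtain ⟨J₁, J₂, h₁, h₂, hne, ⟨A⟩⟩ := exists_isLowerSet_intervalFrame hfin hF
    exact ⟨_, .death h₁ h₂, hne, ⟨A.retract _⟩⟩
  rcases subsingleton_or_nontrivial (F.space (⊤, ⊤)) with htop | htop
  case inr =>
    obtain ⟨J₁, J₂, h₁, h₂, hne, ⟨A⟩⟩ := exists_isUpperSet_intervalFrame hfin hF
    exact ⟨_, .birth h₁ h₂, hne, ⟨A.retract _⟩⟩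
  obtain ⟨⟨s, t⟩, hst⟩ := exists_nontrivial_of_not_isZero hF₀
  obtain ⟨⟨r₁⟩, ⟨r₂⟩⟩ := hF.nonempty_retract_comap_top
  rcases subsingleton_or_nontrivial ((F.comap (.prod .id (.const S ⊤))).space s) with h₁ | h₁
  case inr =>
    obtain ⟨J, hJ, hne, ⟨A⟩⟩ := exists_intervalFrame_of_linearOrder (s₀ := s)
      (hfin.comap (.prod .id (.const S ⊤)))
    have A' := Set.prod_univ ▸ A.comap (OrderHom.fst : S × T →o S)
    exact ⟨J ×ˢ Set.univ, .vertical hJ, hne.prod Set.univ_nonempty, ⟨.trans (A'.retract _) r₁⟩⟩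
  rcases subsingleton_or_nontrivial ((F.comap (.prod (.const T ⊤) .id)).space t) with h₂ | h₂
  case inr =>
    obtain ⟨J, hJ, hne, ⟨A⟩⟩ := exists_intervalFrame_of_linearOrder (s₀ := t)
      (hfin.comap (.prod (.const T ⊤) .id))
    have A' := Set.univ_prod ▸ A.comap (OrderHom.snd : S × T →o T)
    exact ⟨Set.univ ×ˢ J, .horizontal hJ, Set.univ_nonempty.prod hne, ⟨.trans (A'.retract _) r₂⟩⟩
  have : Subsingleton (F.space (s, ⊤)) := h₁
  have : Subsingleton (F.space (⊤, t)) := h₂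
  exact (not_subsingleton _ (hF.bijective_prod_of_subsingleton s t).injective.subsingleton).elim

end Blocks

noncomputable section OrthogonalRetracts

universe w

variable {𝒞 : Type w} {𝒟 : Type*} [Category 𝒞] [Category 𝒟] [Preadditive 𝒟]
  {ι : Type*} {X : ι → 𝒞 ⥤ 𝒟} {F G H : 𝒞 ⥤ 𝒟}

/-- A family of retracts of a functor is pairwise orthogonal if the composites between different
members through the functor vanish. -/
def IsOrthogonalFamily (r : ∀ i, Retract (X i) F) : Prop :=
  Pairwise fun i j => (r i).i ≫ (r j).r = 0

/-- A family of retracts of a functor is pointwise finite if only finitely many of its projections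
are nonzero at each object, so that sums over the family make sense. -/
def IsPointwiseFiniteFamily (r : ∀ i, Retract (X i) F) : Prop :=
  ∀ c, {i | (r i).r.app c ≠ 0}.Finite

variable {r : ∀ i, Retract (X i) F}

namespace IsPointwiseFiniteFamily

theorem hasFiniteSupport_comp (hr : IsPointwiseFiniteFamily r) {c : 𝒞} {A : 𝒟}
    (g : ∀ i, (X i).obj c ⟶ A) : Function.HasFiniteSupport fun i => (r i).r.app c ≫ g i :=
  (hr c).subset fun i hi h => hi (by simp [h])

theorem small (hr : IsPointwiseFiniteFamily r) (hX : ∀ i, ¬ IsZero (X i)) : Small.{w} ι := by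
  have (c : 𝒞) : Small.{w} {i | (r i).r.app c ≠ 0} :=
    have := (hr c).to_subtype
    inferInstance
  rw [← small_univ_iff]
  refine small_subset (s := ⋃ c, {i | (r i).r.app c ≠ 0}) fun i _ => ?_
  by_contra hi
  simp only [Set.mem_iUnion, Set.mem_ofPred_eq, not_exists, not_not] at hi
  have hri : (r i).r = 0 := NatTrans.ext (funext hi)
  exact hX i ((IsZero.iff_id_eq_zero _).2 (by rw [← (r i).retract, hri, comp_zero]))

/-- The morphism with given restrictions to the members of an orthogonal family which vanishes on
the complement: the sum of the projections of the family followed by these restrictions. -/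
def glue (hr : IsPointwiseFiniteFamily r) (g : ∀ i, X i ⟶ G) : F ⟶ G where
  app c := ∑ᶠ i, (r i).r.app c ≫ (g i).app c
  naturality c d f := calc
    F.map f ≫ ∑ᶠ i, (r i).r.app d ≫ (g i).app d
    _ = ∑ᶠ i, F.map f ≫ (r i).r.app d ≫ (g i).app d :=
      (Preadditive.leftComp _ (F.map f)).map_finsum (hr.hasFiniteSupport_comp _)
    _ = ∑ᶠ i, ((r i).r.app c ≫ (g i).app c) ≫ G.map f := by simp
    _ = (∑ᶠ i, (r i).r.app c ≫ (g i).app c) ≫ G.map f :=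
      ((Preadditive.rightComp _ (G.map f)).map_finsum (hr.hasFiniteSupport_comp _)).symm

theorem glue_comp (hr : IsPointwiseFiniteFamily r) (g : ∀ i, X i ⟶ G) (k : G ⟶ H) :
    hr.glue g ≫ k = hr.glue fun i => g i ≫ k := by
  ext c
  calc (∑ᶠ i, (r i).r.app c ≫ (g i).app c) ≫ k.app c
    _ = ∑ᶠ i, ((r i).r.app c ≫ (g i).app c) ≫ k.app c :=
      (Preadditive.rightComp _ (k.app c)).map_finsum (hr.hasFiniteSupport_comp _)
    _ = ∑ᶠ i, (r i).r.app c ≫ (g i ≫ k).app c := by simp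

theorem i_comp_glue (hr : IsPointwiseFiniteFamily r) (horth : IsOrthogonalFamily r)
    (g : ∀ i, X i ⟶ G) (j : ι) : (r j).i ≫ hr.glue g = g j := by
  ext c
  have hzero (i : ι) (hij : i ≠ j) : (r j).i.app c ≫ (r i).r.app c ≫ (g i).app c = 0 := by
    rw [← Category.assoc, ← NatTrans.comp_app, horth hij.symm, zero_app, zero_comp]
  calc (r j).i.app c ≫ ∑ᶠ i, (r i).r.app c ≫ (g i).app c
    _ = ∑ᶠ i, (r j).i.app c ≫ (r i).r.app c ≫ (g i).app c :=
      (Preadditive.leftComp _ ((r j).i.app c)).map_finsum (hr.hasFiniteSupport_comp _)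
    _ = (r j).i.app c ≫ (r j).r.app c ≫ (g j).app c := finsum_eq_single _ j hzero
    _ = (g j).app c := by rw [← Category.assoc, ← NatTrans.comp_app, (r j).retract]; simp

theorem glue_i_comp_r (hr : IsPointwiseFiniteFamily r) (horth : IsOrthogonalFamily r) (j : ι) :
    hr.glue (fun i => (r i).i) ≫ (r j).r = (r j).r := by
  rw [glue_comp]
  ext c
  calc ∑ᶠ i, (r i).r.app c ≫ ((r i).i ≫ (r j).r).app c
    _ = (r j).r.app c ≫ ((r j).i ≫ (r j).r).app c :=
      finsum_eq_single _ j fun i hij => by rw [horth hij, zero_app, comp_zero]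
    _ = (r j).r.app c := by simp

theorem glue_i_idem (hr : IsPointwiseFiniteFamily r) (horth : IsOrthogonalFamily r) :
    hr.glue (fun i => (r i).i) ≫ hr.glue (fun i => (r i).i) = hr.glue fun i => (r i).i := by
  rw [glue_comp]
  simp only [hr.i_comp_glue horth]

theorem nonempty_iso_coproduct (hr : IsPointwiseFiniteFamily r) (horth : IsOrthogonalFamily r)
    (hsum : hr.glue (fun i => (r i).i) = 𝟙 F) [HasCoproduct X] : Nonempty (F ≅ ∐ X) := by
  let c : Cofan X := Cofan.mk F fun i => (r i).i
  have hc : IsColimit c := Cofan.IsColimit.mk c (fun s => hr.glue s.inj)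
    (fun s j => hr.i_comp_glue horth s.inj j) fun s m hm => calc
      m = hr.glue (fun i => (r i).i) ≫ m := by rw [hsum]; exact (Category.id_comp m).symm
      _ = hr.glue s.inj := by rw [glue_comp]; exact congrArg hr.glue (funext hm)
  exact ⟨hc.coconePointUniqueUpToIso (colimit.isColimit _)⟩

theorem exists_orthogonal_retract [IsIdempotentComplete (𝒞 ⥤ 𝒟)]
    (hr : IsPointwiseFiniteFamily r) (horth : IsOrthogonalFamily r)
    (hsum : hr.glue (fun i => (r i).i) ≠ 𝟙 F) :
    ∃ (Y : 𝒞 ⥤ 𝒟) (s : Retract Y F), ¬ IsZero Y ∧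
      ∀ i, s.i ≫ (r i).r = 0 ∧ (r i).i ≫ s.r = 0 := by
  let e := hr.glue fun i => (r i).i
  obtain ⟨Y, i, p, hip, hpi⟩ := IsIdempotentComplete.idempotents_split F (𝟙 F - e)
    (Idempotents.idem_of_id_sub_idem e (hr.glue_i_idem horth))
  have hi : i = i ≫ (𝟙 F - e) := by rw [← hpi, ← Category.assoc, hip, Category.id_comp]
  have hp : p = (𝟙 F - e) ≫ p := by rw [← hpi, Category.assoc, hip, Category.comp_id]
  refine ⟨Y, ⟨i, p, hip⟩, fun hY => hsum ?_, fun j => ⟨?_, ?_⟩⟩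
  · exact (sub_eq_zero.1 (by rw [← hpi, hY.eq_of_tgt p 0, zero_comp])).symm
  · change i ≫ (r j).r = 0
    rw [hi, Category.assoc, Preadditive.sub_comp, hr.glue_i_comp_r horth, Category.id_comp,
      sub_self, comp_zero]
  · change (r j).i ≫ p = 0
    rw [hp, ← Category.assoc, Preadditive.comp_sub, hr.i_comp_glue horth, Category.comp_id,
      sub_self, zero_comp]

end IsPointwiseFiniteFamily

end OrthogonalRetracts

section Decomposition

open PersistenceModule

variable {K : Type u} [Field K] {P : Type} [PartialOrder P] {F : PersistenceModule K P}

theorem IsPointwiseFiniteDimensional.isPointwiseFiniteFamily (hF : IsPointwiseFiniteDimensional F)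
    {ι : Type*} {X : ι → PersistenceModule K P} {r : ∀ i, Retract (X i) F}
    (horth : IsOrthogonalFamily r) : IsPointwiseFiniteFamily r := by
  intro p
  have (i : {i | (r i).r.app p ≠ 0}) : ∃ x : (X i).space p, x ≠ 0 := by
    by_contra! h
    exact i.2 (ModuleCat.hom_ext (LinearMap.ext fun y => h _))
  choose x hx using this
  choose φ hφ using fun i => Module.Projective.exists_dual_eq_one K (hx i)
  have hlin : LinearIndependent K fun i => component (r i.1).i p (x i) :=
    .of_pairwise_dual_eq_zero_one _ (fun i => φ i ∘ₗ component (r i.1).r p)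
      (fun i j hij => by
        have h : component ((r j).i ≫ (r i).r) p (x j) = 0 := by
          rw [horth (Subtype.coe_ne_coe.2 hij.symm)]
          rfl
        exact (congrArg (φ i) h).trans (map_zero _))
      fun i => by simp [retract_app, hφ]
  have := hF p
  exact hlin.finite_of_isNoetherian

theorem exists_maximal_orthogonal_retracts {C : Type*} [Category C] [HasZeroMorphisms C]
    {𝒥 : Type*} (X : 𝒥 → C) (A : C) :
    ∃ 𝒮 : Set (Σ j, Retract (X j) A), (𝒮.Pairwise fun a b => a.2.i ≫ b.2.r = 0) ∧
      ∀ j (s : Retract (X j) A), (∀ a ∈ 𝒮, s.i ≫ a.2.r = 0 ∧ a.2.i ≫ s.r = 0) →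
        IsZero (X j) := by
  obtain ⟨𝒮, h𝒮, hmax⟩ := zorn_subset
    {𝒮 : Set (Σ j, Retract (X j) A) | 𝒮.Pairwise fun a b => a.2.i ≫ b.2.r = 0}
    fun c hc hchain =>
      ⟨⋃₀ c, (Set.pairwise_sUnion hchain.directedOn).2 hc, fun _ => Set.subset_sUnion_of_mem⟩
  refine ⟨𝒮, h𝒮, fun j s hs => (IsZero.iff_id_eq_zero _).2 ?_⟩
  have hmem : ⟨j, s⟩ ∈ 𝒮 := hmax (h𝒮.insert fun a ha _ => hs a ha)
    (Set.subset_insert _ 𝒮) (Set.mem_insert _ 𝒮)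
  exact s.retract.symm.trans (hs _ hmem).1

/-- The complement of the sum of a maximal orthogonal family of retracts is zero, since otherwise
the family could be enlarged by a retract of that complement. -/
theorem exists_iso_coproduct_of_retracts (hF : IsPointwiseFiniteDimensional F) {𝒥 : Type*}
    {X : 𝒥 → PersistenceModule K P} (hX : ∀ j, ¬ IsZero (X j))
    (hret : ∀ Y, Retract Y F → ¬ IsZero Y → ∃ j, Nonempty (Retract (X j) Y)) :
    ∃ (ι : Type) (j : ι → 𝒥), Nonempty (F ≅ ∐ fun i => X (j i)) := by
  obtain ⟨𝒮, h𝒮, hmax⟩ := exists_maximal_orthogonal_retracts X F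
  have horth : IsOrthogonalFamily fun a : 𝒮 => a.1.2 := fun a b hab =>
    h𝒮 a.2 b.2 (Subtype.coe_ne_coe.2 hab)
  have : Small.{0} 𝒮 := (hF.isPointwiseFiniteFamily horth).small fun a => hX a.1.1
  let e := (equivShrink.{0} 𝒮).symm
  have horth' : IsOrthogonalFamily fun i => (e i).1.2 := horth.comp_of_injective e.injective
  have hr := hF.isPointwiseFiniteFamily horth'
  refine ⟨Shrink.{0} 𝒮, fun i => (e i).1.1, hr.nonempty_iso_coproduct horth' ?_⟩
  by_contra hsum
  obtain ⟨Y, s, hY, hs⟩ := hr.exists_orthogonal_retract horth' hsum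
  obtain ⟨j, ⟨t⟩⟩ := hret Y s hY
  refine hX j (hmax j (t.trans s) fun a ha => ?_)
  obtain ⟨h₁, h₂⟩ := hs (e.symm ⟨a, ha⟩)
  rw [e.apply_symm_apply] at h₁ h₂
  constructor
  · change (t.i ≫ s.i) ≫ a.2.r = 0
    rw [Category.assoc, h₁, comp_zero]
  · change a.2.i ≫ s.r ≫ t.r = 0
    rw [← Category.assoc, h₂, zero_comp]

end Decomposition

theorem mainTheorem6_general {K : Type u} [Field K] {S T : Type} [LinearOrder S] [LinearOrder T]
    [BoundedOrder S] [BoundedOrder T] (F : PersistenceModule K (S × T))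
    (hfin : IsPointwiseFiniteDimensional F) (hF : IsMiddleExact F) :
    ∃ (ι : Type) (B : ι → Set (S × T)) (hB : ∀ i, IsProductBlock (B i)),
      Nonempty (F ≅ ∐ fun i : ι => intervalModule K (hB i).isInterval) := by
  let X (I : {I : Set (S × T) // IsProductBlock I ∧ I.Nonempty}) : PersistenceModule K (S × T) :=
    intervalModule K I.2.1.isInterval
  obtain ⟨ι, B, ⟨e⟩⟩ := exists_iso_coproduct_of_retracts hfin (X := X)
    (fun I => not_isZero_intervalModule _ I.2.2) fun Y r hY => by
      obtain ⟨I, hI, hne, hr⟩ := exists_isProductBlock_retract (hfin.of_retract r)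
        (hF.isWeaklyCartesian.of_retract r) hY
      exact ⟨⟨I, hI, hne⟩, hr⟩
  exact ⟨ι, fun i => (B i).1, fun i => (B i).2.1, ⟨e⟩⟩

theorem mainTheorem6 {K : Type u} [Field K]
    (F : PersistenceModule K (ℝ≥0∞ × ℝ≥0∞))
    (hfin : IsPointwiseFiniteDimensional F) (hF : IsMiddleExact F) :
    ∃ (ι : Type) (B : ι → Set (ℝ≥0∞ × ℝ≥0∞)) (hB : ∀ i, IsBlock (B i)),
      Nonempty (F ≅ ∐ fun i : ι => intervalModule K (hB i).isInterval) := by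
  obtain ⟨ι, B, hB, e⟩ := mainTheorem6_general F hfin hF
  exact ⟨ι, B, fun i => (hB i).isBlock, e⟩
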